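/- Let $k$ be a field, $Q=k[x_1,\dots,x_N]$, and let $I=(m_1,\dots,m_q)$ be an ideal of $Q$ generated by monomials $m_1,\dots,m_q$. For $\tau\subseteq\{1,\dots,q\}$ put $m_\tau=\operatorname{lcm}(m_i : i\in\tau)$ (with $m_\emptyset=1$), and let $$\operatorname{scarf}(I)=\inf\{t\in\mathbb N : \text{there are } \tau\neq\tau'\subseteq\{1,\dots,q\} \text{ with } |\tau|=t,\ m_\tau=m_{\tau'}\}\in\mathbb N\cup\{\infty\}$$ be the Scarf number, formed with the given generators (the usual choice being the minimal monomial generators of $I$). Let $r\ge 1$, let $a_1,\dots,a_r\in I$ be a regular sequence in $Q$, and let $R=Q/(a_1,\dots,a_r)$. Write $R/I$ for $R/IR$, and let $$\beta_i^R(R/I)=\dim_k \operatorname{Tor}_i^R(k,R/I),\qquad k=R/(x_1,\dots,x_N)R,$$ be its Betti numbers; if $R/I$ has a minimal free resolution over $R$ (as it does in the graded case), $\beta_i^R(R/I)$ is the rank of its $i$-th free module. (If $I=Q$, then $R/I=0$ and all its Betti numbers are $0$.) Then for every integer $i\ge 0$ the Betti numbers $\beta_{2i}^R(R/I)$ and $\beta_{2i+1}^R(R/I)$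 are finite and $$\beta_{2i}^R(R/I)\le\sum_{j=0}^{i}\left(\binom{q}{2j}-\binom{q-\operatorname{scarf}(I)}{2j-\operatorname{scarf}(I)}\right)\binom{r+i-j-1}{r-1},$$ $$\beta_{2i+1}^R(R/I)\le\sum_{j=0}^{i}\left(\binom{q}{2j+1}-\binom{q-\operatorname{scarf}(I)}{2j+1-\operatorname{scarf}(I)}\right)\binom{r+i-j-1}{r-1},$$ where a binomial coefficient $\binom{q-\operatorname{scarf}(I)}{l-\operatorname{scarf}(I)}$ with $l<\operatorname{scarf}(I)$, in particular with $\operatorname{scarf}(I)=\infty$, is $0$. -/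

import Mathlib

/-! ### Free resolutions and Betti numbers -/

universe u

section Betti

open CategoryTheory MonoidalCategory
open scoped TensorProduct

variable {R : Type u} [CommRing R]

/-- The `i`-th Betti number of `M` over `R` relative to the maximal ideal `𝔪`: the dimension over
`R ⧸ 𝔪` of `Tor_i^R(R ⧸ 𝔪, M)`. As `Tor` is annihilated by `𝔪`, this dimension is the length of
`Tor` as an `R`-module, a value in `ℕ∞` (so that an infinite dimension is `⊤`).
See `bettiNumber_eq_rank` for the description by minimal free resolutions. -/
noncomputable def bettiNumber (𝔪 : Ideal R) (M : Type u) [AddCommGroup M] [Module R M] (i : ℕ) :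
    ℕ∞ :=
  Module.length R
    (((Tor (ModuleCat.{u} R) i).obj (ModuleCat.of R (R ⧸ 𝔪))).obj (ModuleCat.of R M))

/-- A free resolution `⋯ → R^{n₁} → R^{n₀} → M → 0` by free modules of finite rank. -/
structure FreeResolution (R : Type u) [CommRing R] (M : Type u) [AddCommGroup M] [Module R M] where
  /-- the rank `n i` of the free module in degree `i` -/
  n : ℕ → ℕ
  /-- the differential from degree `i + 1` to degree `i` -/
  d : ∀ i, (Fin (n (i + 1)) → R) →ₗ[R] (Fin (n i) → R)
  /-- the augmentation -/
  aug : (Fin (n 0) → R) →ₗ[R] M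
  aug_surjective : Function.Surjective aug
  exact_zero : Function.Exact (d 0) aug
  exact_succ : ∀ i, Function.Exact (d (i + 1)) (d i)

namespace FreeResolution

variable {M : Type u} [AddCommGroup M] [Module R M]

/-- A free resolution is minimal if `∂ F_{i+1} ⊆ 𝔪 F_i` for all `i`. -/
def IsMinimal (F : FreeResolution R M) (𝔪 : Ideal R) : Prop :=
  ∀ i, LinearMap.range (F.d i) ≤ 𝔪 • (⊤ : Submodule R (Fin (F.n i) → R))

/-- The underlying chain complex of a free resolution. -/
noncomputable def complex (F : FreeResolution R M) : ChainComplex (ModuleCat.{u} R) ℕ :=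
  ChainComplex.of (fun i => ModuleCat.of R (Fin (F.n i) → R)) (fun i => ModuleCat.ofHom (F.d i))
    (fun i => by
      rw [← ModuleCat.ofHom_comp, (F.exact_succ i).linearMap_comp_eq_zero]; rfl)

lemma complex_d (F : FreeResolution R M) (i : ℕ) :
    F.complex.d (i + 1) i = ModuleCat.ofHom (F.d i) :=
  ChainComplex.of_d (fun i => ModuleCat.of R (Fin (F.n i) → R)) (fun i => ModuleCat.ofHom (F.d i)) i

/-- The augmentation as a morphism out of degree `0` of the complex. -/
noncomputable def complexAug (F : FreeResolution R M) : F.complex.X 0 ⟶ ModuleCat.of R M :=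
  ModuleCat.ofHom F.aug

lemma complex_d_comp (F : FreeResolution R M) : F.complex.d 1 0 ≫ F.complexAug = 0 := by
  rw [F.complex_d 0]
  refine (ModuleCat.ofHom_comp _ _).symm.trans ?_
  rw [F.exact_zero.linearMap_comp_eq_zero]; rfl

/-- A free resolution is a projective resolution in Mathlib's sense. -/
noncomputable def toProjectiveResolution (F : FreeResolution R M) :
    ProjectiveResolution (ModuleCat.of R M) where
  complex := F.complex
  projective i := ModuleCat.projective_of_free (M := ModuleCat.of R (Fin (F.n i) → R))
    (Pi.basisFun R (Fin (F.n i)))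
  π := (ChainComplex.toSingle₀Equiv _ _).symm ⟨F.complexAug, F.complex_d_comp⟩
  quasiIso := ⟨fun i => by
    cases i with
    | zero =>
      rw [ChainComplex.quasiIsoAt₀_iff, ShortComplex.quasiIso_iff_of_zeros']
      · refine ⟨?_, ?_⟩
        · rw [ShortComplex.moduleCat_exact_iff]
          intro x hx
          have hx' : F.aug x = 0 := by
            have h := hx
            change (((ChainComplex.toSingle₀Equiv F.complex (ModuleCat.of R M)).symm
              ⟨F.complexAug, F.complex_d_comp⟩).f 0) x = 0 at h
            rw [ChainComplex.toSingle₀Equiv_symm_apply_f_zero] at h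
            exact h
          obtain ⟨y, hy⟩ := (F.exact_zero x).1 hx'
          refine ⟨y, ?_⟩
          change F.complex.d 1 0 y = x
          rw [F.complex_d 0]
          exact hy
        · rw [ModuleCat.epi_iff_surjective]
          change Function.Surjective (((ChainComplex.toSingle₀Equiv F.complex
            (ModuleCat.of R M)).symm ⟨F.complexAug, F.complex_d_comp⟩).f 0)
          rw [ChainComplex.toSingle₀Equiv_symm_apply_f_zero]
          exact F.aug_surjective
      all_goals rfl
    | succ i =>
      rw [quasiIsoAt_iff_exactAt']
      · rw [HomologicalComplex.exactAt_iff' _ (i + 2) (i + 1) i (by simp) (by simp),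
          ShortComplex.moduleCat_exact_iff]
        intro x hx
        change F.complex.d (i + 1) i x = 0 at hx
        rw [F.complex_d i] at hx
        obtain ⟨y, hy⟩ := (F.exact_succ i x).1 hx
        refine ⟨y, ?_⟩
        change F.complex.d (i + 2) (i + 1) y = x
        rw [F.complex_d (i + 1)]
        exact hy
      · apply ChainComplex.exactAt_succ_single_obj⟩

/-- If `M` has a minimal free resolution, then its Betti numbers are the ranks of the free
modules in it. -/
theorem bettiNumber_eq_rank (F : FreeResolution R M) (𝔪 : Ideal R) [𝔪.IsMaximal]
    (hF : F.IsMinimal 𝔪) (i : ℕ) : bettiNumber 𝔪 M i = F.n i := by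
  let N : ModuleCat.{u} R := ModuleCat.of R (R ⧸ 𝔪)
  let K := (((tensoringLeft (ModuleCat.{u} R)).obj N).mapHomologicalComplex
    (ComplexShape.down ℕ)).obj F.complex
  have hd : ∀ j k, K.d j k = 0 := by
    intro j k
    by_cases hjk : k + 1 = j
    · subst hjk
      change N ◁ F.complex.d (k + 1) k = 0
      rw [F.complex_d k]
      refine ModuleCat.hom_ext (TensorProduct.ext' fun a x => ?_)
      change a ⊗ₜ[R] F.d k x = 0
      have hx : F.d k x ∈ 𝔪 • (⊤ : Submodule R (Fin (F.n k) → R)) := hF k ⟨x, rfl⟩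
      refine Submodule.smul_induction_on (p := fun y => a ⊗ₜ[R] y = 0) hx ?_ ?_
      · intro c hc y _
        rw [← TensorProduct.smul_tmul]
        obtain ⟨b, rfl⟩ := Ideal.Quotient.mk_surjective a
        have h0 : c • (Ideal.Quotient.mk 𝔪 b) = 0 :=
          Ideal.Quotient.eq_zero_iff_mem.2 (𝔪.mul_mem_right b hc)
        rw [h0, TensorProduct.zero_tmul]
      · intro y z hy hz
        rw [TensorProduct.tmul_add, hy, hz, add_zero]
    · exact K.shape _ _ hjk
  have e1 : ((Tor (ModuleCat.{u} R) i).obj N).obj (ModuleCat.of R M) ≅ K.homology i :=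
    F.toProjectiveResolution.isoLeftDerivedObj ((tensoringLeft (ModuleCat.{u} R)).obj N) i
  have e2 : K.homology i ≅ K.X i := by
    have := K.isIso_homologyι i _ rfl (hd _ _)
    have := (K.sc i).isIso_pOpcycles (hd _ _)
    exact asIso (K.homologyι i) ≪≫ (asIso (K.sc i).pOpcycles).symm
  have e3 : (R ⧸ 𝔪) ⊗[R] (Fin (F.n i) → R) ≃ₗ[R] (Fin (F.n i) → R ⧸ 𝔪) :=
    TensorProduct.piScalarRight R R (R ⧸ 𝔪) (Fin (F.n i))
  have e4 : ((Tor (ModuleCat.{u} R) i).obj N).obj (ModuleCat.of R M) ≃ₗ[R]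
      (Fin (F.n i) → R ⧸ 𝔪) := (e1 ≪≫ e2).toLinearEquiv.trans e3
  have : IsSimpleModule R (R ⧸ 𝔪) := by
    rw [isSimpleModule_iff_isCoatom]; exact Ideal.IsMaximal.out
  unfold bettiNumber
  rw [e4.length_eq, Module.length_pi_of_fintype]
  simp

end FreeResolution

end Betti

/-! ### Monomial ideals, the Scarf number, and ranks of the smallest pivot resolution -/

section Monomial

/-- The ideal generated by the monomials `x^{m_1}, …, x^{m_q}`, given by their exponent vectors. -/
noncomputable def monomialIdeal (k : Type u) [Field k] {N q : ℕ} (m : Fin q → Fin N →₀ ℕ) :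
    Ideal (MvPolynomial (Fin N) k) :=
  Ideal.span (Set.range fun i => MvPolynomial.monomial (m i) (1 : k))

/-- The Scarf number: the infimum in `ℕ ∪ {∞}` of all `t` for which there are distinct
`τ, τ' ⊆ {1, …, q}` with `|τ| = t` and `lcm (m_i : i ∈ τ) = lcm (m_i : i ∈ τ')`. On exponent
vectors the least common multiple is the componentwise maximum. -/
noncomputable def scarfNumber {N q : ℕ} (m : Fin q → Fin N →₀ ℕ) : ℕ∞ :=
  sInf {t : ℕ∞ | ∃ τ τ' : Finset (Fin q), τ ≠ τ' ∧ (τ.card : ℕ∞) = t ∧ τ.sup m = τ'.sup m}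

open Classical in
/-- The binomial coefficient `binom (q - s) (j - s)`, which is `0` for `j < s`, and in particular
for `s = ∞`. -/
noncomputable def scarfChoose (q : ℕ) (s : ℕ∞) (j : ℕ) : ℕ :=
  if s ≤ (j : ℕ∞) then (q - s.toNat).choose (j - s.toNat) else 0

/-- `binom q j - binom (q - s) (j - s)`. -/
noncomputable def pivotRank (q : ℕ) (s : ℕ∞) (j : ℕ) : ℕ :=
  q.choose j - scarfChoose q s j

/-- A finite Scarf number is at most `q`, so that the subtraction `q - s` is never truncated. -/
lemma scarfNumber_le_or_eq_top {N q : ℕ} (m : Fin q → Fin N →₀ ℕ) :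
    scarfNumber m ≤ q ∨ scarfNumber m = ⊤ := by
  by_cases h : ∃ τ τ' : Finset (Fin q), τ ≠ τ' ∧ τ.sup m = τ'.sup m
  · obtain ⟨τ, τ', hne, hs⟩ := h
    left
    have hle : scarfNumber m ≤ (τ.card : ℕ∞) := sInf_le ⟨τ, τ', hne, rfl, hs⟩
    refine hle.trans ?_
    exact_mod_cast (Finset.card_le_univ τ).trans_eq (Fintype.card_fin q)
  · right
    refine sInf_eq_top.2 ?_
    rintro t ⟨τ, τ', hne, -, hs⟩
    exact absurd ⟨τ, τ', hne, hs⟩ h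

/-- The subtraction in `pivotRank` is never truncated. -/
lemma scarfChoose_le {N q : ℕ} (m : Fin q → Fin N →₀ ℕ) (j : ℕ) :
    scarfChoose q (scarfNumber m) j ≤ q.choose j := by
  unfold scarfChoose
  split_ifs with hj
  · have hne : scarfNumber m ≠ ⊤ := ne_top_of_le_ne_top (ENat.natCast_ne_top j) hj
    have hq := (scarfNumber_le_or_eq_top m).resolve_right hne
    obtain ⟨s, hs⟩ := ENat.ne_top_iff_exists.1 hne
    rw [← hs] at hj hq ⊢
    have hj' : s ≤ j := by exact_mod_cast hj
    have hq' : s ≤ q := by exact_mod_cast hq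
    simp only [ENat.toNat_natCast]
    have key : ∀ a b c : ℕ, a.choose b ≤ (a + c).choose (b + c) := by
      intro a b c
      induction c with
      | zero => simp
      | succ c ih =>
        refine ih.trans ?_
        rw [← add_assoc, ← add_assoc, Nat.choose_succ_succ]
        exact Nat.le_add_right _ _
    have := key (q - s) (j - s) s
    rwa [Nat.sub_add_cancel hq', Nat.sub_add_cancel hj'] at this
  · exact Nat.zero_le _

/-- For `Q = k[x_1, …, x_N]`, `R = Q ⧸ (a_1, …, a_r)` and an ideal `I` of `Q`, the Betti number
`β_i^R(R/I)` of `R/I = R ⧸ IR` over `R`, relative to the ideal of `R` generated by the variables. -/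
noncomputable def quotientBetti {k : Type u} [Field k] {N r : ℕ}
    (a : Fin r → MvPolynomial (Fin N) k) (I : Ideal (MvPolynomial (Fin N) k)) (i : ℕ) : ℕ∞ :=
  bettiNumber (R := MvPolynomial (Fin N) k ⧸ Ideal.span (Set.range a))
    ((Ideal.span (Set.range MvPolynomial.X)).map (Ideal.Quotient.mk (Ideal.span (Set.range a))))
    ((MvPolynomial (Fin N) k ⧸ Ideal.span (Set.range a)) ⧸
      I.map (Ideal.Quotient.mk (Ideal.span (Set.range a)))) i

end Monomial

/-! ### Truncated free resolutions -/

/-! Tor is a subquotient of `(R ⧸ 𝔪) ⊗ F_i` for any free resolution `F`, so it suffices to construct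
some resolution of `R/I` over `R` with the stated ranks; minimality plays no role. Only iterated
syzygies and ranks are tracked, never explicit differentials, and only to finite length: over a
noetherian ring a truncated resolution extends to a full one.

Over `Q`, adding a monomial `m_e` to an ideal `B` gives the exact sequence `0 → Q/(B : m_e) → Q/B →
Q/(B + (m_e)) → 0`, whose mapping cone adds ranks; iterating it gives the Taylor ranks (`taylor`).
If `τ` attains the Scarf number, minimality yields `j ∉ τ` with `m_j ∣ m_τ` (`scarf`). Taking `e ∈
τ` and passing to the colon ideal preserves this divisibility for `τ \ {e}`; after `|τ|` such steps
the ideal contains `1` and its quotient vanishes, which saves the subtracted binomial coefficient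
(`pivot`).

To pass from `S` to `S' = S/a` with `a` regular and `aM = 0`, cover `M` by a free module `F` with
kernel `K`. Then `aF ⊆ K`, the syzygy of `M` over `S'` is `K/aF`, and multiplication by `a` gives `0
→ M → K/aK → K/aF → 0`. The resolution of `K` reduces modulo `a`, and a mapping cone with a shorter
resolution of `M` over `S'` yields the ranks `p l + p (l - 2) + ⋯` (`hypersurface`). Applying this
to each `a_s` in turn produces the coefficients in the bound (`iterate_hypersurfaceRank`). -/

/-- `HasTruncatedResolution R n M p` says that `M` has the first `n` steps of a free resolution,
with free modules of ranks `p 0, p 1, …, p (n - 1)`. -/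
def HasTruncatedResolution (R : Type u) [CommRing R] :
    ℕ → ∀ (M : Type u) [AddCommGroup M] [Module R M], (ℕ → ℕ) → Prop
  | 0, _, _, _, _ => True
  | n + 1, M, _, _, p => ∃ f : (Fin (p 0) → R) →ₗ[R] M, Function.Surjective f ∧
      HasTruncatedResolution R n (LinearMap.ker f) (fun i => p (i + 1))

namespace HasTruncatedResolution

variable {R : Type u} [CommRing R] {M M' A B C : Type u} [AddCommGroup M] [Module R M]
  [AddCommGroup M'] [Module R M'] [AddCommGroup A] [Module R A] [AddCommGroup B] [Module R B]
  [AddCommGroup C] [Module R C] {n : ℕ} {p q : ℕ → ℕ}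

lemma congr (h : HasTruncatedResolution R n M p) (e : M ≃ₗ[R] M') :
    HasTruncatedResolution R n M' p := by
  cases n with
  | zero => trivial
  | succ n =>
    obtain ⟨f, hf, h⟩ := h
    refine ⟨e.toLinearMap ∘ₗ f, e.surjective.comp hf, ?_⟩
    rwa [LinearEquiv.ker_comp]

lemma of_surjective {F : Type u} [AddCommGroup F] [Module R F] (φ : F ≃ₗ[R] (Fin (p 0) → R))
    (f : F →ₗ[R] M) (hf : Function.Surjective f)
    (h : HasTruncatedResolution R n (LinearMap.ker f) (fun i => p (i + 1))) :
    HasTruncatedResolution R (n + 1) M p := by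
  refine ⟨f ∘ₗ φ.symm.toLinearMap, hf.comp φ.symm.surjective, h.congr
    ((φ.submoduleMap (LinearMap.ker f)).trans (LinearEquiv.ofEq _ _ ?_))⟩
  rw [LinearMap.ker_comp]
  exact Submodule.map_equiv_eq_comap_symm φ _

lemma of_succ (h : HasTruncatedResolution R (n + 1) M p) : HasTruncatedResolution R n M p := by
  induction n generalizing M p with
  | zero => trivial
  | succ n ih =>
    obtain ⟨f, hf, h⟩ := h
    exact ⟨f, hf, ih h⟩

lemma of_subsingleton [Subsingleton M] : HasTruncatedResolution R n M (fun _ => 0) := by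
  induction n generalizing M with
  | zero => trivial
  | succ n ih => exact ⟨0, fun x => ⟨0, Subsingleton.elim _ _⟩, ih⟩

/-- A free module of rank one has the resolution concentrated in degree zero. -/
lemma of_equiv_self (e : R ≃ₗ[R] M) :
    HasTruncatedResolution R n M (fun l => if l = 0 then 1 else 0) := by
  cases n with
  | zero => trivial
  | succ n =>
    refine of_surjective (LinearEquiv.funUnique (Fin 1) R R).symm e.toLinearMap e.surjective ?_
    have : Subsingleton (LinearMap.ker e.toLinearMap) := by
      rw [LinearEquiv.ker]
      infer_instance
    simpa using of_subsingleton

/-- The direct sum of `R^a` and `R^b` is `R^(a + b)`. -/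
noncomputable def finProdEquiv (R : Type u) [CommRing R] (a b : ℕ) :
    ((Fin a → R) × (Fin b → R)) ≃ₗ[R] (Fin (a + b) → R) :=
  (LinearEquiv.sumArrowLequivProdArrow (Fin a) (Fin b) R R).symm.trans
    (LinearEquiv.funCongrLeft R R finSumFinEquiv.symm)

/-- The horseshoe lemma. -/
lemma horseshoe (hA : HasTruncatedResolution R n A p) (hC : HasTruncatedResolution R n C q)
    (i : A →ₗ[R] B) (g : B →ₗ[R] C) (hi : Function.Injective i) (hg : Function.Surjective g)
    (hig : Function.Exact i g) : HasTruncatedResolution R n B (fun l => p l + q l) := by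
  induction n generalizing A B C p q with
  | zero => trivial
  | succ n ih =>
    obtain ⟨α, hα, hA⟩ := hA
    obtain ⟨γ, hγ, hC⟩ := hC
    obtain ⟨γ', hγ'⟩ := Module.projective_lifting_property g γ hg
    have hγ'' : ∀ y, g (γ' y) = γ y := fun y => LinearMap.congr_fun hγ' y
    have hgi : ∀ x, g (i x) = 0 := hig.apply_apply_eq_zero
    let f : ((Fin (p 0) → R) × (Fin (q 0) → R)) →ₗ[R] B := (i ∘ₗ α).coprod γ'
    have hf : ∀ x y, f (x, y) = i (α x) + γ' y := fun x y => by simp [f]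
    refine of_surjective (finProdEquiv R (p 0) (q 0)) f ?_ ?_
    · intro b
      obtain ⟨y, hy⟩ := hγ (g b)
      obtain ⟨a, ha⟩ := (hig (b - γ' y)).1 (by rw [map_sub, hγ'', hy, sub_self])
      obtain ⟨x, rfl⟩ := hα a
      exact ⟨(x, y), by rw [hf, ha]; abel⟩
    · refine ih hA hC
        ((LinearMap.inl R (Fin (p 0) → R) (Fin (q 0) → R)).restrict (p := LinearMap.ker α)
          (q := LinearMap.ker f) fun x hx => ?_)
        ((LinearMap.snd R (Fin (p 0) → R) (Fin (q 0) → R)).restrict (p := LinearMap.ker f)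
          (q := LinearMap.ker γ) fun x hx => ?_) ?_ ?_ ?_
      · rw [LinearMap.mem_ker] at hx ⊢
        rw [LinearMap.inl_apply, hf, hx]; simp
      · rw [LinearMap.mem_ker] at hx ⊢
        obtain ⟨x, y⟩ := x
        rw [hf] at hx
        simpa [hgi, hγ''] using congrArg g hx
      · rintro ⟨x, hx⟩ ⟨y, hy⟩ hxy
        simpa [Subtype.ext_iff, Prod.ext_iff] using hxy
      · rintro ⟨y, hy⟩
        rw [LinearMap.mem_ker] at hy
        obtain ⟨a, ha⟩ := (hig (γ' y)).1 (by rw [hγ'', hy])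
        obtain ⟨x, rfl⟩ := hα a
        exact ⟨⟨(-x, y), by rw [LinearMap.mem_ker, hf, map_neg, map_neg, ha, neg_add_cancel]⟩,
          rfl⟩
      · rintro ⟨⟨x, y⟩, hxy⟩
        rw [LinearMap.mem_ker, hf] at hxy
        constructor
        · intro h
          have hy : y = 0 := congrArg Subtype.val h
          subst hy
          refine ⟨⟨x, hi ?_⟩, rfl⟩
          simpa using hxy
        · rintro ⟨⟨x', hx'⟩, h⟩
          have : ((x', 0) : (Fin (p 0) → R) × (Fin (q 0) → R)) = (x, y) := congrArg Subtype.val h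
          exact Subtype.ext (Prod.ext_iff.1 this).2.symm

/-- The mapping cone resolution of a cokernel. -/
lemma cokernel (hA : HasTruncatedResolution R n A p) (hB : HasTruncatedResolution R (n + 1) B q)
    (i : A →ₗ[R] B) (g : B →ₗ[R] C) (hi : Function.Injective i) (hg : Function.Surjective g)
    (hig : Function.Exact i g) : HasTruncatedResolution R (n + 1) C
      (fun l => q l + if l = 0 then 0 else p (l - 1)) := by
  obtain ⟨β, hβ, hB⟩ := hB
  have hgi : ∀ x, g (i x) = 0 := hig.apply_apply_eq_zero
  refine ⟨g ∘ₗ β, hg.comp hβ, ?_⟩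
  let e := LinearEquiv.ofInjective i hi
  have hr : LinearMap.range i = LinearMap.ker g := (LinearMap.exact_iff.1 hig).symm
  -- The syzygy of `C` sits in `0 → ker β → ker (g ∘ β) → ker g → 0`, and `ker g = range i` is a
  -- copy of `A`; this accounts for the degree shift.
  refine horseshoe (A := LinearMap.ker β) (C := LinearMap.range i) hB (hA.congr e)
    (Submodule.inclusion fun x hx => ?_)
    (β.restrict fun x hx => ?_) (Submodule.inclusion_injective _) ?_ ?_
  · rw [LinearMap.mem_ker] at hx ⊢
    rw [LinearMap.comp_apply, hx, map_zero]
  · rw [hr]; exact hx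
  · rintro ⟨y, hy⟩
    obtain ⟨x, rfl⟩ := hβ y
    rw [hr] at hy
    exact ⟨⟨x, hy⟩, rfl⟩
  · rintro ⟨x, hx⟩
    constructor
    · intro h
      exact ⟨⟨x, congrArg Subtype.val h⟩, rfl⟩
    · rintro ⟨⟨y, hy⟩, h⟩
      have : y = x := congrArg Subtype.val h
      subst this
      exact Subtype.ext hy

end HasTruncatedResolution

/-! ### Change of rings -/

namespace HasTruncatedResolution

variable {S S' : Type u} [CommRing S] [CommRing S'] {φ : S →+* S'} {n : ℕ} {p : ℕ → ℕ}

/-- Application of a ring homomorphism to all coordinates, as a semilinear map. -/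
def mapCoords (φ : S →+* S') (b : ℕ) : (Fin b → S) →ₛₗ[φ] (Fin b → S') where
  toFun x := φ ∘ x
  map_add' x y := by ext; simp
  map_smul' c x := by ext; simp

lemma mapCoords_surjective (hφ : Function.Surjective φ) (b : ℕ) :
    Function.Surjective (mapCoords φ b) := hφ.comp_left

lemma mapCoords_eq_zero_iff {a : S} (hker : RingHom.ker φ = Ideal.span {a}) {b : ℕ}
    (x : Fin b → S) : mapCoords φ b x = 0 ↔ ∃ y, x = a • y := by
  have h (j : Fin b) : φ (x j) = 0 ↔ ∃ c, x j = a * c := by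
    rw [← RingHom.mem_ker, hker, Ideal.mem_span_singleton]; rfl
  constructor
  · intro hx
    choose y hy using fun j => (h j).1 (congrFun hx j)
    exact ⟨y, funext hy⟩
  · rintro ⟨y, rfl⟩
    funext j
    exact (h j).2 ⟨y j, rfl⟩

/-- The linear map out of a free module over `S'` induced by one over `S`. -/
lemma exists_linearMap_mapCoords {K : Type u} [AddCommGroup K] [Module S K] {K' : Type u}
    [AddCommGroup K'] [Module S' K'] (π : K →ₛₗ[φ] K') {b : ℕ} (f : (Fin b → S) →ₗ[S] K) :
    ∃ f' : (Fin b → S') →ₗ[S'] K', ∀ x, f' (mapCoords φ b x) = π (f x) := by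
  refine ⟨(Pi.basisFun S' (Fin b)).constr S' fun j => π (f (Pi.single j 1)), fun x => ?_⟩
  conv_rhs => rw [pi_eq_sum_univ' x]
  simp [Module.Basis.constr_apply_fintype, mapCoords, map_sum]

/-- Reduction of a resolution modulo `a`, if `a` is zero or regular on the module. -/
lemma baseChange {a : S} (hφ : Function.Surjective φ) (hker : RingHom.ker φ = Ideal.span {a})
    (haS : a = 0 ∨ IsSMulRegular S a)
    {K : Type u} [AddCommGroup K] [Module S K] {K' : Type u} [AddCommGroup K'] [Module S' K']
    (ha : a = 0 ∨ IsSMulRegular K a) (π : K →ₛₗ[φ] K') (hπ : Function.Surjective π)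
    (hπa : ∀ x, π x = 0 ↔ ∃ y, x = a • y) (h : HasTruncatedResolution S n K p) :
    HasTruncatedResolution S' n K' p := by
  induction n generalizing K K' p with
  | zero => trivial
  | succ n ih =>
    obtain ⟨f, hf, h⟩ := h
    obtain ⟨f', hf'⟩ := exists_linearMap_mapCoords π f
    refine ⟨f', fun y => ?_, ?_⟩
    · obtain ⟨x, rfl⟩ := hπ y
      obtain ⟨x, rfl⟩ := hf x
      exact ⟨_, hf' x⟩
    · let ρ : LinearMap.ker f →ₛₗ[φ] LinearMap.ker f' :=
        ((mapCoords φ (p 0)).domRestrict (LinearMap.ker f)).codRestrict _ fun x => by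
          rw [LinearMap.mem_ker]
          change f' (mapCoords φ (p 0) x) = 0
          rw [hf', LinearMap.mem_ker.1 x.2, map_zero]
      have hρ (x) : (ρ x : Fin (p 0) → S') = mapCoords φ (p 0) x := rfl
      have haz (w : Fin (p 0) → S) : mapCoords φ (p 0) (a • w) = 0 :=
        (mapCoords_eq_zero_iff hker _).2 ⟨w, rfl⟩
      refine ih ?_ ρ ?_ ?_ h
      -- The syzygy lies in a free module, so regularity on `S` suffices from here on.
      · refine haS.imp_right fun haS x y hxy => Subtype.ext (funext fun j => haS ?_)
        exact congrFun (congrArg Subtype.val hxy) j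
      · rintro ⟨y, hy⟩
        obtain ⟨x, rfl⟩ := mapCoords_surjective hφ _ y
        rw [LinearMap.mem_ker, hf', hπa] at hy
        obtain ⟨z, hz⟩ := hy
        obtain ⟨w, rfl⟩ := hf z
        refine ⟨⟨x - a • w, by simp [hz]⟩, Subtype.ext ?_⟩
        rw [hρ]
        simp only [map_sub, haz, sub_zero]
      · rintro ⟨x, hx⟩
        rw [← Subtype.coe_inj, hρ]
        refine (mapCoords_eq_zero_iff hker x).trans ⟨?_, ?_⟩
        · rintro ⟨w, rfl⟩
          -- Regularity on `K` gives `ker f ∩ aF = a ker f`: if `a • f w = 0`, then `f w = 0`.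
          rcases ha with rfl | ha
          · exact ⟨0, Subtype.ext (by simp)⟩
          · refine ⟨⟨w, ?_⟩, rfl⟩
            rw [LinearMap.mem_ker, map_smul] at hx
            rw [LinearMap.mem_ker]
            exact ha (by simpa using hx)
        · rintro ⟨w, hw⟩
          exact ⟨w, congrArg Subtype.val hw⟩

/-- The ranks `p l + p (l - 2) + p (l - 4) + ⋯` of the standard resolution over a hypersurface. -/
def hypersurfaceRank (p : ℕ → ℕ) : ℕ → ℕ
  | 0 => p 0
  | 1 => p 1
  | l + 2 => p (l + 2) + hypersurfaceRank p l

/-- A module over a quotient by a surjection, given by the action of the source. -/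
lemma exists_module_of_surjective (hφ : Function.Surjective φ) (K : Type u) [AddCommGroup K]
    [Module S K] (h : ∀ s ∈ RingHom.ker φ, ∀ x : K, s • x = 0) :
    ∃ _ : Module S' K, ∀ (s : S) (x : K), φ s • x = s • x := by
  have hs (s : S) : φ (Function.surjInv hφ (φ s)) = φ s := Function.surjInv_eq hφ _
  have key (s t : S) (hst : φ s = φ t) (x : K) : s • x = t • x := by
    rw [← sub_eq_zero, ← sub_smul]
    exact h _ (by rw [RingHom.mem_ker, map_sub, hst, sub_self]) x
  let _ : SMul S' K := ⟨fun s x => Function.surjInv hφ s • x⟩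
  have hsm : ∀ (s : S) (x : K), φ s • x = s • x := fun s x => key _ _ (hs s) x
  exact ⟨Function.Surjective.moduleLeft φ hφ hsm, hsm⟩

/-- Resolutions over a hypersurface: if `a` is a nonzerodivisor of `S` and `S' = S/a`, then a
resolution over `S` of an `S'`-module gives one over `S'`. -/
lemma hypersurface {a : S} (hφ : Function.Surjective φ) (hker : RingHom.ker φ = Ideal.span {a})
    (ha : IsSMulRegular S a) {M : Type u} [AddCommGroup M] [Module S M] [Module S' M]
    (hM : ∀ (s : S) (x : M), φ s • x = s • x) (h : HasTruncatedResolution S n M p) :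
    HasTruncatedResolution S' n M (hypersurfaceRank p) := by
  induction n using Nat.strong_induction_on with
  | _ n ih =>
  cases n with
  | zero => trivial
  | succ n =>
    -- The module `M` reappears inside its own syzygy over `S'`, but two degrees later, so a shorter
    -- truncation is enough.
    have hM' : HasTruncatedResolution S' n M (hypersurfaceRank p) := ih n n.lt_succ_self h.of_succ
    obtain ⟨f, hf, hK⟩ := h
    have hφa : φ a = 0 := by
      rw [← RingHom.mem_ker, hker]; exact Ideal.mem_span_singleton_self a
    have haM (x : M) : a • x = 0 := by rw [← hM, hφa, zero_smul]
    have haF : ∀ x y : Fin (p 0) → S, a • x = a • y → x = y :=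
      fun x y hxy => funext fun j => ha (congrFun hxy j)
    obtain ⟨f', hf'⟩ := exists_linearMap_mapCoords (φ := φ)
      ({ toFun := id, map_add' := fun _ _ => rfl, map_smul' := fun s x => (hM s x).symm } :
        M →ₛₗ[φ] M) f
    replace hf' : ∀ x, f' (mapCoords φ (p 0) x) = f x := hf'
    let K := LinearMap.ker f
    let L : Submodule S K := LinearMap.range (LinearMap.lsmul S K a)
    have hL (x : K) : L.mkQ x = 0 ↔ ∃ y, x = a • y := by
      rw [← LinearMap.mem_ker, Submodule.ker_mkQ]
      exact exists_congr fun y => eq_comm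
    obtain ⟨_, hKL⟩ := exists_module_of_surjective (S' := S') hφ (K ⧸ L) fun s hs x => by
      rw [hker, Ideal.mem_span_singleton] at hs
      obtain ⟨c, rfl⟩ := hs
      obtain ⟨x, rfl⟩ := L.mkQ_surjective x
      rw [← map_smul, hL]
      exact ⟨c • x, mul_smul _ _ _⟩
    have hKbar : HasTruncatedResolution S' n (K ⧸ L) (fun l => p (l + 1)) := by
      refine baseChange (φ := φ) (a := a) hφ hker (.inr ha) (K := K) (.inr ?_)
        { toFun := L.mkQ, map_add' := map_add _, map_smul' := fun s x => ?_ } ?_ hL hK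
      · exact fun x y hxy => Subtype.ext (haF _ _ (congrArg Subtype.val hxy))
      · rw [hKL, map_smul]
      · exact L.mkQ_surjective
    refine ⟨f', fun y => ?_, ?_⟩
    · obtain ⟨x, rfl⟩ := hf y
      exact ⟨_, hf' x⟩
    cases n with
    | zero => trivial
    | succ n =>
    -- multiplication by `a` induces a map from `M` to `K ⧸ L`
    let μ : (Fin (p 0) → S) →ₗ[S] K :=
      (LinearMap.lsmul S (Fin (p 0) → S) a).codRestrict K fun x => by
        simp [K, haM]
    have hμ (x) : (μ x : Fin (p 0) → S) = a • x := rfl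
    have hμf (x) : L.mkQ (μ x) = 0 ↔ f x = 0 := by
      rw [hL]
      constructor
      · rintro ⟨y, hy⟩
        rw [haF x y (congrArg Subtype.val hy)]
        exact y.2
      · exact fun hx => ⟨⟨x, hx⟩, rfl⟩
    let i₀ : M →ₗ[S] K ⧸ L := (K.liftQ (L.mkQ ∘ₗ μ) fun x hx => (hμf x).2 hx) ∘ₗ
      (f.quotKerEquivOfSurjective hf).symm.toLinearMap
    have hi₀ (x) : i₀ (f x) = L.mkQ (μ x) := by
      have : (f.quotKerEquivOfSurjective hf).symm (f x) = K.mkQ x := by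
        rw [LinearEquiv.symm_apply_eq]; rfl
      simp only [i₀, LinearMap.comp_apply, LinearEquiv.coe_coe, this]
      rfl
    let i : M →ₗ[S'] K ⧸ L :=
      { toFun := i₀
        map_add' := map_add _
        map_smul' := fun s x => by
          obtain ⟨s, rfl⟩ := hφ s
          rw [hM, map_smul, RingHom.id_apply, hKL] }
    let ρ : K →ₛₗ[φ] LinearMap.ker f' :=
      ((mapCoords φ (p 0)).domRestrict K).codRestrict _ fun x => by
        rw [LinearMap.mem_ker]
        exact (hf' x).trans x.2
    have hρ (x) : (ρ x : Fin (p 0) → S') = mapCoords φ (p 0) x := rfl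
    have hρ0 (x) : ρ x = 0 ↔ ∃ w, (x : Fin (p 0) → S) = a • w := by
      rw [← Subtype.coe_inj, hρ]
      exact mapCoords_eq_zero_iff hker _
    have hLρ : L ≤ LinearMap.ker ρ := by
      rintro _ ⟨y, rfl⟩
      exact (hρ0 _).2 ⟨y, rfl⟩
    let g : (K ⧸ L) →ₗ[S'] LinearMap.ker f' :=
      { toFun := L.liftQ ρ hLρ
        map_add' := map_add _
        map_smul' := fun s x => by
          obtain ⟨s, rfl⟩ := hφ s
          rw [hKL, LinearMap.map_smulₛₗ, RingHom.id_apply] }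
    have hg (x : K) : g (L.mkQ x) = ρ x := rfl
    have hres := cokernel (hM'.of_succ) hKbar i g ?_ ?_ ?_
    · have heq : (fun l => hypersurfaceRank p (l + 1)) =
          fun l => p (l + 1) + if l = 0 then 0 else hypersurfaceRank p (l - 1) := by
        funext l
        cases l <;> rfl
      rw [heq]
      exact hres
    · refine (injective_iff_map_eq_zero i).2 fun x hx => ?_
      obtain ⟨x, rfl⟩ := hf x
      exact (hμf x).1 ((hi₀ x).symm.trans hx)
    · rintro ⟨y, hy⟩
      obtain ⟨x, rfl⟩ := mapCoords_surjective hφ _ y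
      rw [LinearMap.mem_ker, hf'] at hy
      exact ⟨L.mkQ ⟨x, hy⟩, rfl⟩
    · intro y
      obtain ⟨x, rfl⟩ := L.mkQ_surjective y
      rw [hg, hρ0]
      constructor
      · rintro ⟨w, hw⟩
        refine ⟨f w, (hi₀ w).trans (congrArg L.mkQ (Subtype.ext hw.symm))⟩
      · rintro ⟨m, hm⟩
        obtain ⟨w, rfl⟩ := hf m
        have h1 : L.mkQ (μ w) = L.mkQ x := (hi₀ w).symm.trans hm
        rw [← sub_eq_zero, ← map_sub, hL] at h1
        obtain ⟨y, hy⟩ := h1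
        refine ⟨w - y, ?_⟩
        have := congrArg Subtype.val hy
        simp only [AddSubgroupClass.coe_sub, hμ, SetLike.val_smul] at this
        rw [smul_sub, ← this]; abel

end HasTruncatedResolution

/-! ### Resolutions of monomial ideals -/

section MonomialResolution

variable {k : Type u} [Field k] {N : ℕ}

lemma mem_monomialIdeal_iff {q : ℕ} (m : Fin q → Fin N →₀ ℕ) (x : MvPolynomial (Fin N) k) :
    x ∈ monomialIdeal k m ↔ ∀ c ∈ x.support, ∃ i, m i ≤ c := by
  have : (Set.range fun i => MvPolynomial.monomial (m i) (1 : k)) =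
      (fun s => MvPolynomial.monomial s (1 : k)) '' Set.range m := Set.range_comp (fun s => MvPolynomial.monomial s (1 : k)) m
  rw [monomialIdeal, this, MvPolynomial.mem_ideal_span_monomial_image]
  simp

/-- The colon ideal of a monomial ideal by a monomial. -/
lemma monomial_mul_mem_monomialIdeal_iff {q : ℕ} (m : Fin q → Fin N →₀ ℕ) (c : Fin N →₀ ℕ)
    (x : MvPolynomial (Fin N) k) :
    MvPolynomial.monomial c 1 * x ∈ monomialIdeal k m ↔
      x ∈ monomialIdeal k (fun i => m i - c) := by
  -- Truncated subtraction of exponents is division by the gcd, and `m i - c ≤ b` is equivalent to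
  -- `m i ≤ b + c`.
  simp only [mem_monomialIdeal_iff, tsub_le_iff_right]
  constructor
  · intro h b hb
    obtain ⟨i, hi⟩ := h (b + c) (by
      rw [MvPolynomial.mem_support_iff] at hb ⊢
      rwa [add_comm, MvPolynomial.coeff_monomial_mul, one_mul])
    exact ⟨i, hi⟩
  · intro h b hb
    rw [MvPolynomial.mem_support_iff, MvPolynomial.coeff_monomial_mul'] at hb
    split_ifs at hb with hcb
    · obtain ⟨i, hi⟩ := h (b - c) (by
        rw [MvPolynomial.mem_support_iff]; simpa using hb)
      exact ⟨i, hi.trans_eq (tsub_add_cancel_of_le hcb)⟩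
    · exact absurd rfl hb

/-- The mapping cone of adding the generator `m e` to the others. -/
lemma HasTruncatedResolution.monomialIdeal_succAbove {q n : ℕ} (m : Fin (q + 1) → Fin N →₀ ℕ)
    (e : Fin (q + 1)) {p p' : ℕ → ℕ}
    (hcolon : HasTruncatedResolution (MvPolynomial (Fin N) k) n
      (MvPolynomial (Fin N) k ⧸ monomialIdeal k fun i => m (e.succAbove i) - m e) p)
    (h : HasTruncatedResolution (MvPolynomial (Fin N) k) (n + 1)
      (MvPolynomial (Fin N) k ⧸ monomialIdeal k fun i => m (e.succAbove i)) p') :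
    HasTruncatedResolution (MvPolynomial (Fin N) k) (n + 1)
      (MvPolynomial (Fin N) k ⧸ monomialIdeal k m)
      (fun l => p' l + if l = 0 then 0 else p (l - 1)) := by
  set A := monomialIdeal k fun i => m (e.succAbove i) - m e with hA
  set B := monomialIdeal k fun i => m (e.succAbove i) with hB
  set C := monomialIdeal k m with hC
  have hmul (x : MvPolynomial (Fin N) k) : MvPolynomial.monomial (m e) 1 * x ∈ B ↔ x ∈ A :=
    monomial_mul_mem_monomialIdeal_iff _ _ _
  have hsup : C = Ideal.span {MvPolynomial.monomial (m e) 1} ⊔ B := by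
    rw [hC, hB, monomialIdeal, monomialIdeal, ← Ideal.span_union]
    congr 1
    ext x
    simp only [Set.mem_range, Set.mem_union, Set.mem_singleton_iff, Fin.exists_iff_succAbove e]
    exact or_congr_left eq_comm
  refine HasTruncatedResolution.cokernel hcolon h
    (Submodule.mapQ A B (LinearMap.mulLeft _ (MvPolynomial.monomial (m e) 1))
      fun x hx => (hmul x).2 hx)
    (Submodule.factor (hsup ▸ le_sup_right)) ?_ (Submodule.factor_surjective _) ?_
  · rw [injective_iff_map_eq_zero]
    intro x hx
    obtain ⟨x, rfl⟩ := Submodule.mkQ_surjective _ x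
    refine (Submodule.Quotient.mk_eq_zero _).2 ((hmul x).1 ?_)
    exact (Submodule.Quotient.mk_eq_zero _).1 hx
  · intro y
    obtain ⟨y, rfl⟩ := Submodule.mkQ_surjective _ y
    have h1 : Submodule.factor (hsup ▸ le_sup_right : B ≤ C) (B.mkQ y) = 0 ↔ y ∈ C :=
      Submodule.Quotient.mk_eq_zero _
    rw [h1, hsup, Submodule.mem_sup]
    constructor
    · rintro ⟨a, ha, b, hb, rfl⟩
      obtain ⟨c, rfl⟩ := Ideal.mem_span_singleton.1 ha
      refine ⟨A.mkQ c, ?_⟩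
      rw [map_add, (Submodule.Quotient.mk_eq_zero B).2 hb |> id (α := B.mkQ b = 0), add_zero]
      rfl
    · rintro ⟨x, hx⟩
      obtain ⟨x, rfl⟩ := Submodule.mkQ_surjective _ x
      have h2 : y - MvPolynomial.monomial (m e) 1 * x ∈ B := by
        rw [← Submodule.Quotient.mk_eq_zero, Submodule.Quotient.mk_sub, sub_eq_zero]
        exact hx.symm
      exact ⟨_, Ideal.mul_mem_right x _ (Ideal.mem_span_singleton_self _), _, h2, by ring⟩

/-- The ranks of the Taylor resolution. -/
lemma HasTruncatedResolution.taylor {q n : ℕ} (m : Fin q → Fin N →₀ ℕ) :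
    HasTruncatedResolution (MvPolynomial (Fin N) k) n
      (MvPolynomial (Fin N) k ⧸ monomialIdeal k m) (fun l => q.choose l) := by
  induction q generalizing n with
  | zero =>
    have h0 : monomialIdeal k m = ⊥ := by
      rw [monomialIdeal, Set.range_eq_empty, Ideal.span_empty]
    have := of_equiv_self (n := n) (Submodule.quotEquivOfEqBot _ h0).symm
    convert this using 2 with l
    cases l <;> rfl
  | succ q ih =>
    cases n with
    | zero => trivial
    | succ n =>
      -- Both the colon ideal and the smaller ideal have `q` generators, so the ranks add up by
      -- Pascal's rule.
      have := monomialIdeal_succAbove m 0 (ih (n := n) _) (ih (n := n + 1) _)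
      convert this using 2 with l
      cases l with
      | zero => simp
      | succ l => simp [Nat.choose_succ_succ, add_comm]

lemma scarfChoose_natCast (q s l : ℕ) :
    scarfChoose q s l = if s ≤ l then (q - s).choose (l - s) else 0 := by
  simp [scarfChoose]

lemma scarfChoose_natCast_le {q s : ℕ} (h : s ≤ q) (l : ℕ) : scarfChoose q s l ≤ q.choose l := by
  rw [scarfChoose_natCast]
  split_ifs with hl
  · obtain ⟨a, rfl⟩ := Nat.exists_eq_add_of_le' h
    obtain ⟨b, rfl⟩ := Nat.exists_eq_add_of_le' hl
    simp only [Nat.add_sub_cancel]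
    clear h hl
    induction s with
    | zero => exact le_rfl
    | succ s ih => exact ih.trans (Nat.choose_succ_succ (a + s) (b + s) ▸ Nat.le_add_right _ _)
  · exact Nat.zero_le _

/-- The ranks of the smallest pivot resolution, if a generator divides the least common multiple
of `s` others. -/
lemma HasTruncatedResolution.pivot {q n s : ℕ} (m : Fin q → Fin N →₀ ℕ) (τ : Finset (Fin q))
    (hτ : τ.card = s) (j : Fin q) (hj : j ∉ τ) (hle : m j ≤ τ.sup m) :
    HasTruncatedResolution (MvPolynomial (Fin N) k) n
      (MvPolynomial (Fin N) k ⧸ monomialIdeal k m) (pivotRank q s) := by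
  induction s generalizing q n with
  | zero =>
    rw [Finset.card_eq_zero] at hτ
    subst hτ
    have hj0 : m j = 0 := le_bot_iff.1 hle
    have htop : monomialIdeal k m = ⊤ := by
      rw [Ideal.eq_top_iff_one]
      exact Ideal.subset_span ⟨j, by simp [hj0]⟩
    have : Subsingleton (MvPolynomial (Fin N) k ⧸ monomialIdeal k m) :=
      Ideal.Quotient.subsingleton_iff.2 htop
    have h0 : pivotRank q ((0 : ℕ) : ℕ∞) = fun _ => 0 := by
      funext l
      simp [pivotRank, scarfChoose]
    rw [h0]
    exact of_subsingleton
  | succ s ih =>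
    obtain ⟨e, he⟩ := Finset.card_pos.1 (s.succ_pos.trans_eq hτ.symm)
    cases q with
    | zero => exact e.elim0
    | succ q =>
    cases n with
    | zero => trivial
    | succ n =>
    obtain ⟨j', rfl⟩ := Fin.exists_succAbove_eq (x := j) (y := e) (fun h => hj (h ▸ he))
    let τ' : Finset (Fin q) := τ.preimage e.succAbove Fin.succAbove_right_injective.injOn
    have hmap : τ = insert e (τ'.map e.succAboveEmb) := by
      ext i
      rcases Fin.eq_self_or_eq_succAbove e i with rfl | ⟨i, rfl⟩
      · simp [he]
      · simp [τ', Fin.succAbove_ne]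
    have hcard : τ'.card = s := by
      rw [hmap, Finset.card_insert_of_notMem (by simp [Fin.succAbove_ne]), Finset.card_map] at hτ
      omega
    have hsq : s ≤ q := by
      rw [← hcard]; exact (Finset.card_le_univ _).trans_eq (Fintype.card_fin q)
    -- The relation `m_j ∣ m_τ` survives the colon by `m_e`: every `m_i` with `i ∈ τ` divides `m_e`
    -- times the lcm of the colon generators indexed by `τ'`.
    have hle' : m (e.succAbove j') - m e ≤ τ'.sup fun i => m (e.succAbove i) - m e := by
      rw [tsub_le_iff_right]
      refine hle.trans (Finset.sup_le fun i hi => ?_)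
      rcases Fin.eq_self_or_eq_succAbove e i with rfl | ⟨i, rfl⟩
      · exact le_add_of_nonneg_left (bot_le (a := _))
      · rw [← tsub_le_iff_right]
        exact Finset.le_sup (f := fun i => m (e.succAbove i) - m e) (by simpa [τ'] using hi)
    -- Only the colon ideal inherits the divisibility; the other ideal contributes full Taylor
    -- ranks.
    have := monomialIdeal_succAbove m e
      (ih (n := n) (fun i => m (e.succAbove i) - m e) τ' hcard j' (by simpa [τ'] using hj) hle')
      (taylor (n := n + 1) _)
    convert this using 2 with l
    cases l with
    | zero => simp [pivotRank, scarfChoose]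
    | succ l =>
      have h1 := scarfChoose_natCast_le hsq l
      have h2 : scarfChoose (q + 1) (s + 1 : ℕ) (l + 1) = scarfChoose q s l := by
        rw [scarfChoose_natCast, scarfChoose_natCast]
        simp
      simp only [pivotRank, h2, Nat.choose_succ_succ', Nat.succ_ne_zero, if_false,
        Nat.add_sub_cancel]
      omega

/-- The ranks of the smallest pivot resolution. -/
lemma HasTruncatedResolution.scarf {q n : ℕ} (m : Fin q → Fin N →₀ ℕ) :
    HasTruncatedResolution (MvPolynomial (Fin N) k) n
      (MvPolynomial (Fin N) k ⧸ monomialIdeal k m) (pivotRank q (scarfNumber m)) := by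
  set T := {t : ℕ∞ | ∃ τ τ' : Finset (Fin q), τ ≠ τ' ∧ (τ.card : ℕ∞) = t ∧ τ.sup m = τ'.sup m}
    with hT
  rcases T.eq_empty_or_nonempty with h | h
  · have hs : scarfNumber m = ⊤ := by rw [scarfNumber, ← hT, h, sInf_empty]
    rw [hs]
    convert taylor m using 2 with l
    simp [pivotRank, scarfChoose]
  · obtain ⟨τ, τ', hne, hcard, hsup⟩ := csInf_mem h
    have hs : scarfNumber m = (τ.card : ℕ∞) := hcard.symm
    -- A proper subset of `τ` with the same lcm would contradict the minimality of `|τ|`.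
    have hsub : ¬ τ' ⊆ τ := fun hsub => by
      have hlt := Finset.card_lt_card (hsub.ssubset_of_ne hne.symm)
      have hmin : scarfNumber m ≤ (τ'.card : ℕ∞) := sInf_le ⟨τ', τ, hne.symm, rfl, hsup.symm⟩
      rw [hs] at hmin
      exact absurd hlt (not_lt.2 (by exact_mod_cast hmin))
    obtain ⟨j, hj', hj⟩ := Finset.not_subset.1 hsub
    rw [hs]
    exact pivot m τ rfl j hj (hsup ▸ Finset.le_sup hj')

end MonomialResolution

/-! ### Betti numbers are bounded by the ranks of a resolution -/

section BettiBound

open CategoryTheory MonoidalCategory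
open scoped TensorProduct

namespace FreeResolution

variable {R : Type u} [CommRing R] {M : Type u} [AddCommGroup M] [Module R M]

/-- The Betti numbers are at most the ranks of any free resolution, as long as the residue ring
has length at most one. -/
theorem bettiNumber_le_rank (F : FreeResolution R M) (𝔪 : Ideal R)
    (h𝔪 : Module.length R (R ⧸ 𝔪) ≤ 1) (i : ℕ) : bettiNumber 𝔪 M i ≤ F.n i := by
  let N : ModuleCat.{u} R := ModuleCat.of R (R ⧸ 𝔪)
  let K := (((tensoringLeft (ModuleCat.{u} R)).obj N).mapHomologicalComplex
    (ComplexShape.down ℕ)).obj F.complex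
  have e1 : ((Tor (ModuleCat.{u} R) i).obj N).obj (ModuleCat.of R M) ≅ K.homology i :=
    F.toProjectiveResolution.isoLeftDerivedObj ((tensoringLeft (ModuleCat.{u} R)).obj N) i
  have e3 : (R ⧸ 𝔪) ⊗[R] (Fin (F.n i) → R) ≃ₗ[R] (Fin (F.n i) → R ⧸ 𝔪) :=
    TensorProduct.piScalarRight R R (R ⧸ 𝔪) (Fin (F.n i))
  have hX : Module.length R (K.X i) ≤ F.n i := by
    have : Module.length R (K.X i) = Module.length R (Fin (F.n i) → R ⧸ 𝔪) := e3.length_eq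
    rw [this, Module.length_pi_of_fintype, Finset.sum_const, Finset.card_univ, Fintype.card_fin,
      nsmul_eq_mul]
    exact (mul_le_mul_right h𝔪 _).trans_eq (mul_one _)
  unfold bettiNumber
  rw [e1.toLinearEquiv.length_eq]
  -- Homology embeds in the opcycles, which are a quotient of the `i`-th term.
  refine (Module.length_le_of_injective (K.homologyι i).hom
    ((ModuleCat.mono_iff_injective _).1 inferInstance)).trans (le_trans ?_ hX)
  exact Module.length_le_of_surjective (K.pOpcycles i).hom
    ((ModuleCat.epi_iff_surjective _).1 inferInstance)

/-- Extension of a free resolution of a kernel by one step. -/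
def cons {b : ℕ} (f : (Fin b → R) →ₗ[R] M) (hf : Function.Surjective f)
    (F : FreeResolution R (LinearMap.ker f)) : FreeResolution R M where
  n i := Nat.casesOn i b F.n
  d i := Nat.casesOn i ((LinearMap.ker f).subtype ∘ₗ F.aug) F.d
  aug := f
  aug_surjective := hf
  exact_zero := fun x => by
    constructor
    · intro hx
      obtain ⟨y, hy⟩ := F.aug_surjective ⟨x, hx⟩
      exact ⟨y, congrArg Subtype.val hy⟩
    · rintro ⟨y, rfl⟩
      exact (F.aug y).2
  exact_succ i := by
    cases i with
    | zero =>
      refine fun x => Iff.trans ?_ (F.exact_zero x)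
      exact Submodule.coe_eq_zero
    | succ i => exact F.exact_succ i

/-- Finite modules over a noetherian ring have free resolutions. -/
lemma nonempty_of_finite [IsNoetherianRing R] [Module.Finite R M] :
    Nonempty (FreeResolution R M) := by
  have cover (b : ℕ) (K : Submodule R (Fin b → R)) :
      ∃ (c : ℕ) (f : (Fin c → R) →ₗ[R] (Fin b → R)), LinearMap.range f = K := by
    obtain ⟨c, f, hf⟩ := Module.Finite.exists_fin' R K
    exact ⟨c, K.subtype ∘ₗ f, by
      rw [LinearMap.range_comp, LinearMap.range_eq_top.2 hf, Submodule.map_top,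
        Submodule.range_subtype]⟩
  choose c f hf using cover
  obtain ⟨b, aug, haug⟩ := Module.Finite.exists_fin' R M
  -- The recursion carries the current free module with the syzygies in it; the next differential
  -- covers these syzygies and its kernel is passed on.
  let K : ℕ → Σ b : ℕ, Submodule R (Fin b → R) := fun i =>
    Nat.rec ⟨b, LinearMap.ker aug⟩ (fun _ K => ⟨c K.1 K.2, LinearMap.ker (f K.1 K.2)⟩) i
  exact ⟨{
    n := fun i => (K i).1
    d := fun i => f (K i).1 (K i).2
    aug := aug
    aug_surjective := haug
    exact_zero := LinearMap.exact_iff.2 (hf _ _).symm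
    exact_succ := fun i => LinearMap.exact_iff.2 (hf _ _).symm }⟩

end FreeResolution

namespace HasTruncatedResolution

variable {R : Type u} [CommRing R] {M : Type u} [AddCommGroup M] [Module R M]

/-- Over a noetherian ring a truncated resolution extends to a resolution. -/
lemma exists_freeResolution [IsNoetherianRing R] [Module.Finite R M] {n : ℕ} {p : ℕ → ℕ}
    (h : HasTruncatedResolution R n M p) : ∃ F : FreeResolution R M, ∀ i < n, F.n i = p i := by
  induction n generalizing M p with
  | zero =>
    obtain ⟨F⟩ := FreeResolution.nonempty_of_finite (R := R) (M := M)
    exact ⟨F, fun i hi => absurd hi i.not_lt_zero⟩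
  | succ n ih =>
    obtain ⟨f, hf, h⟩ := h
    obtain ⟨F, hF⟩ := ih h
    refine ⟨F.cons f hf, fun i hi => ?_⟩
    cases i with
    | zero => rfl
    | succ i => exact hF i (Nat.lt_of_succ_lt_succ hi)

/-- The case `𝔪 = ⊤` is needed because the variables generate the unit ideal of `R` when some `a_s`
has a nonzero constant term, which can happen for `I = Q`. -/
lemma bettiNumber_le [IsNoetherianRing R] [Module.Finite R M] {p : ℕ → ℕ} {i : ℕ} {𝔪 : Ideal R}
    (h𝔪 : 𝔪 = ⊤ ∨ 𝔪.IsMaximal) (h : HasTruncatedResolution R (i + 1) M p) :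
    bettiNumber 𝔪 M i ≤ p i := by
  obtain ⟨F, hF⟩ := h.exists_freeResolution
  rw [← hF i i.lt_succ_self]
  refine F.bettiNumber_le_rank 𝔪 ?_ i
  rcases h𝔪 with rfl | h𝔪
  · simp
  · have : IsSimpleModule R (R ⧸ 𝔪) := by
      rw [isSimpleModule_iff_isCoatom]; exact h𝔪.out
    exact (Module.length_eq_one R (R ⧸ 𝔪)).le

end HasTruncatedResolution

end BettiBound

/-! ### Quotients by regular sequences -/

namespace HasTruncatedResolution

/-- Resolutions over a quotient by a regular sequence. -/
lemma regularSequence {Q : Type u} [CommRing Q] {rs : List Q}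
    (hrs : RingTheory.Sequence.IsWeaklyRegular Q rs) {M : Type u} [AddCommGroup M] [Module Q M]
    {n : ℕ} {p : ℕ → ℕ} (h : HasTruncatedResolution Q n M p) {t : ℕ} (ht : t ≤ rs.length)
    {S : Type u} [CommRing S] [Module S M] {ψ : Q →+* S} (hψ : Function.Surjective ψ)
    (hker : RingHom.ker ψ = Ideal.ofList (rs.take t)) (hM : ∀ (c : Q) (x : M), ψ c • x = c • x) :
    HasTruncatedResolution S n M (hypersurfaceRank^[t] p) := by
  induction t generalizing S with
  | zero =>
    -- For `t = 0` the kernel of `ψ` is zero, so this is only transport along an isomorphism of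
    -- rings.
    refine baseChange (φ := ψ) (a := 0) hψ (by simpa using hker) (.inl rfl) (.inl rfl)
      { toFun := id, map_add' := fun _ _ => rfl, map_smul' := fun c x => (hM c x).symm }
      Function.surjective_id (fun x => ?_) h
    simp
  | succ t ih =>
    rw [Function.iterate_succ_apply']
    set J := Ideal.ofList (rs.take t) with hJ
    have htake : RingHom.ker ψ = J ⊔ Ideal.span {rs[t]} := by
      rw [hker, List.take_succ_eq_append_getElem ht, Ideal.ofList_append, Ideal.ofList_singleton]
    let φ : Q ⧸ J →+* S := Ideal.Quotient.lift J ψ fun c hc => by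
      rw [← RingHom.mem_ker, htake]; exact Ideal.mem_sup_left hc
    -- The map `ψ` factors through `Q ⧸ J`, so `M` is already a module over the intermediate
    -- quotient.
    let _ : Module (Q ⧸ J) M := Module.compHom M φ
    have hreg : IsSMulRegular (Q ⧸ J) (Ideal.Quotient.mk J rs[t]) := by
      have := hrs.regular_mod_prev t ht
      rw [smul_eq_mul, Ideal.mul_top] at this
      intro x y hxy
      exact this (by simpa [Algebra.smul_def] using hxy)
    refine hypersurface (φ := φ) (a := Ideal.Quotient.mk J rs[t])
      (Ideal.Quotient.lift_surjective_of_surjective _ _ hψ) ?_ hreg (fun _ _ => rfl)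
      (ih (Nat.le_of_succ_le ht) Ideal.Quotient.mk_surjective Ideal.mk_ker hM)
    refine (Ideal.ker_quotient_lift ψ _).trans ?_
    rw [htake, Ideal.map_sup, Ideal.map_quotient_self, bot_sup_eq,
      Ideal.map_span, Set.image_singleton]

/-- Each application takes partial sums along a parity class `ε`, that is, multiplies the generating
function by `1/(1 - t²)`; the binomial coefficients are those of `(1 - t²)^{-(r+1)}`. -/
lemma iterate_hypersurfaceRank (p : ℕ → ℕ) (r i : ℕ) {ε : ℕ} (hε : ε < 2) :
    hypersurfaceRank^[r + 1] p (2 * i + ε) =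
      ∑ j ∈ Finset.range (i + 1), p (2 * j + ε) * (r + i - j).choose r := by
  have h0 (p : ℕ → ℕ) : hypersurfaceRank p ε = p ε := by
    interval_cases ε <;> rfl
  have hs (p : ℕ → ℕ) (i : ℕ) : hypersurfaceRank p (2 * (i + 1) + ε) =
      p (2 * (i + 1) + ε) + hypersurfaceRank p (2 * i + ε) := by
    rw [show 2 * (i + 1) + ε = 2 * i + ε + 2 by ring]
    rfl
  induction r generalizing i with
  | zero =>
    rw [zero_add, Function.iterate_one]
    induction i with
    | zero => simp [h0]
    | succ i ih =>
      rw [hs, ih, Finset.sum_range_succ _ (i + 1), add_comm]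
      simp
  | succ r ihr =>
    rw [Function.iterate_succ_apply']
    induction i with
    | zero =>
      rw [mul_zero, zero_add, h0]
      simpa using ihr 0
    | succ i ih =>
      -- With the summand `j = i + 1` split off, the two sums over `j ≤ i` combine by Pascal's rule.
      rw [hs, ih, ihr, Finset.sum_range_succ _ (i + 1), Finset.sum_range_succ _ (i + 1),
        add_right_comm, ← Finset.sum_add_distrib]
      congr 1
      · refine Finset.sum_congr rfl fun j hj => ?_
        have hj : j ≤ i := Nat.lt_succ_iff.1 (Finset.mem_range.1 hj)
        rw [← mul_add, show r + 1 + (i + 1) - j = (r + 1 + i - j) + 1 by omega,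
          Nat.choose_succ_succ', show r + (i + 1) - j = r + 1 + i - j by omega]
      · simp

end HasTruncatedResolution

lemma isMaximal_span_range_X (k : Type u) [Field k] (N : ℕ) :
    (Ideal.span (Set.range (MvPolynomial.X : Fin N → MvPolynomial (Fin N) k))).IsMaximal := by
  have h : RingHom.ker (MvPolynomial.constantCoeff (σ := Fin N) (R := k)) =
      Ideal.span (Set.range MvPolynomial.X) := by
    ext x
    rw [← Set.image_univ, MvPolynomial.mem_ideal_span_X_image, RingHom.mem_ker]
    constructor
    · intro hx c hc
      by_contra! hcon
      have : c = 0 := Finsupp.ext fun i => hcon i (Set.mem_univ i)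
      subst this
      exact MvPolynomial.mem_support_iff.1 hc hx
    · intro hx
      by_contra hne
      obtain ⟨i, -, hi⟩ := hx 0 (MvPolynomial.mem_support_iff.2 hne)
      exact hi rfl
  rw [← h]
  exact RingHom.ker_isMaximal_of_surjective _ fun c => ⟨MvPolynomial.C c, by simp⟩

lemma quotientBetti_le {k : Type u} [Field k] {N q r : ℕ} (m : Fin q → Fin N →₀ ℕ)
    (a : Fin r → MvPolynomial (Fin N) k)
    (hreg : RingTheory.Sequence.IsRegular (MvPolynomial (Fin N) k) (List.ofFn a))
    (ha : ∀ s, a s ∈ monomialIdeal k m) (i : ℕ) :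
    quotientBetti a (monomialIdeal k m) i ≤
      (HasTruncatedResolution.hypersurfaceRank^[r] (pivotRank q (scarfNumber m)) i : ℕ) := by
  set I := monomialIdeal k m
  set J := Ideal.span (Set.range a) with hJ
  have hJI : J ≤ I := Ideal.span_le.2 (Set.range_subset_iff.2 ha)
  let _ : Module (MvPolynomial (Fin N) k)
      ((MvPolynomial (Fin N) k ⧸ J) ⧸ I.map (Ideal.Quotient.mk J)) :=
    Module.compHom _ (Ideal.Quotient.mk J)
  -- As all `a_s` lie in `I`, `R/IR` is `Q/I` itself, so its resolution over `Q` applies.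
  let e : (MvPolynomial (Fin N) k ⧸ I) ≃ₗ[MvPolynomial (Fin N) k]
      ((MvPolynomial (Fin N) k ⧸ J) ⧸ I.map (Ideal.Quotient.mk J)) :=
    { (DoubleQuot.quotQuotEquivQuotOfLE hJI).symm with
      map_smul' := fun c x => by
        obtain ⟨x, rfl⟩ := Ideal.Quotient.mk_surjective x
        rfl }
  refine HasTruncatedResolution.bettiNumber_le
    (Ideal.map_eq_top_or_isMaximal_of_surjective _ Ideal.Quotient.mk_surjective
      (isMaximal_span_range_X k N)) ?_
  refine HasTruncatedResolution.regularSequence (ψ := Ideal.Quotient.mk J) hreg.toIsWeaklyRegular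
    ((HasTruncatedResolution.scarf m).congr e) (List.length_ofFn (f := a)).ge
    Ideal.Quotient.mk_surjective ?_ fun _ _ => rfl
  rw [Ideal.mk_ker, List.take_of_length_le (List.length_ofFn (f := a)).le, hJ, Ideal.ofList]
  congr 1
  ext x
  simp [List.mem_ofFn]

theorem theorem5p10 {k : Type u} [Field k] {N q r : ℕ} (hr : 1 ≤ r)
    (m : Fin q → Fin N →₀ ℕ) (a : Fin r → MvPolynomial (Fin N) k)
    (hreg : RingTheory.Sequence.IsRegular (MvPolynomial (Fin N) k) (List.ofFn a))
    (ha : ∀ s, a s ∈ monomialIdeal k m) (i : ℕ) :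
    quotientBetti a (monomialIdeal k m) (2 * i) ≤
        ((∑ j ∈ Finset.range (i + 1),
          pivotRank q (scarfNumber m) (2 * j) * (r + i - j - 1).choose (r - 1) : ℕ) : ℕ∞) ∧
      quotientBetti a (monomialIdeal k m) (2 * i + 1) ≤
        ((∑ j ∈ Finset.range (i + 1),
          pivotRank q (scarfNumber m) (2 * j + 1) * (r + i - j - 1).choose (r - 1) : ℕ) : ℕ∞) := by
  obtain ⟨r, rfl⟩ := Nat.exists_eq_add_of_le' hr
  have hsum (ε : ℕ) (hε : ε < 2) :
      quotientBetti a (monomialIdeal k m) (2 * i + ε) ≤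
        ((∑ j ∈ Finset.range (i + 1), pivotRank q (scarfNumber m) (2 * j + ε) *
          (r + 1 + i - j - 1).choose (r + 1 - 1) : ℕ) : ℕ∞) := by
    refine (quotientBetti_le m a hreg ha _).trans_eq ?_
    rw [HasTruncatedResolution.iterate_hypersurfaceRank _ _ _ hε]
    congr 1
    refine Finset.sum_congr rfl fun j _ => ?_
    rw [Nat.add_sub_cancel, show r + 1 + i - j - 1 = r + i - j by omega]
  exact ⟨hsum 0 (by norm_num), hsum 1 (by norm_num)⟩
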